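/- **Setting.** Let $\Omega\subseteq\mathbb R^d$ be open and let $\mathcal M(\Omega)=\mathcal C_0(\Omega)^*$ be the Banach space of finite signed Radon measures on $\Omega$ with the total variation norm. Let $n\in\mathbb N\cup\{\infty\}$ and let $\mathcal D'_n(\Omega)$ be the space of distributions on $\Omega$ of order at most $n$, i.e. continuous linear functionals on $C^n_c(\Omega)$, so that $\mathcal D'_\infty(\Omega)=\mathcal D'(\Omega)$. Let $P(D)=\sum_{|\alpha|\le N}p_\alpha D^\alpha$ be a linear differential operator with real, measurable, locally integrable coefficients on $\Omega$ that acts on $\mathcal D'_n(\Omega)$ by transposition: for each $\varphi\in C_c^\infty(\Omega)$ the formal adjoint $P(D)^*\varphi=\sum_\alpha(-1)^{|\alpha|}D^\alpha(p_\alpha\varphi)$ (in the weak sense) belongs to $C^n_c(\Omega)$, and $\langle P(D)v,\varphi\rangle:=\langle v,P(D)^*\varphi\rangle$ (e.g. $p_\alpha\in C^\infty(\Omega)$, for any $n$). Let $K\subseteq\Omega$ be open and bounded, such that $P(D)v=P(D)w=0$ in $\Omega$ and $v|_K=w|_K$ imply $v=w$, for $v,w\in\mathcal D'_n(\Omega)$.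 Put $$\mathcal B_P=\{v\in\mathcal D'_n(\Omega): P(D)v\in\mathcal M(\Omega),\ v|_K\in\mathcal M(K)\},\qquad \|v\|=\|P(D)v\|_{TV}+\|v|_K\|_{TV},$$ and $L=P(D):\mathcal B_P\to\mathcal M(\Omega)$. **Green function hypothesis.** For each $x\in\Omega$ there is $u_x\in\mathcal C(\Omega)$ with $P(D)u_x=\delta_x$; the map $x\mapsto u_x\in\mathcal C(\Omega)$ is continuous (uniform convergence on compact sets suffices), and $\sup_{x}\|u_x\|_\infty<\infty$. **Proposition.** Under these hypotheses: 1. $\ker L$ has a closed complement in $\mathcal B_P$; $\operatorname{ran}L$ is closed and has a closed complement in $\mathcal M(\Omega)$. In fact $\operatorname{ran}L=\mathcal M(\Omega)$. 2. There are closed subspaces $V,W$ with $V\oplus\ker L=\mathcal B_P$ and $\operatorname{ran}L\oplus W=\mathcal M(\Omega)$ such that the pseudoinverse $L^+=j_V(L|_V)^{-1}\Pi_{\operatorname{ran}L}$ (where $\Pi_{\operatorname{ran}L}$ is the projection along $W$ and $j_V:V\hookrightarrow\mathcal B_P$ is the inclusion) is continuous and, for each $\mu\in\mathcal M(\Omega)$,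 $L^+\mu$ is the continuous function $$(L^+\mu)(x)=\int_\Omega u_y(x)\,d\mu(y).$$ 3. Let $a\in L^1(\Omega)$ and $\rho(x)=\int_\Omega u_x(y)a(y)\,dy$. Then $\int_\Omega a(y)(L^+\mu)(y)\,dy=\int_\Omega\rho\,d\mu$ for all $\mu\in\mathcal M(\Omega)$, all integrals being absolutely convergent. In particular, if $\ell\in\mathcal B_P^*$ satisfies $\langle\ell,v\rangle=\int_\Omega a(x)v(x)\,dx$ for all bounded continuous functions $v\in\mathcal B_P$, then $(L^+)^*\ell=\rho$, i.e. $\langle(L^+)^*\ell,\mu\rangle=\int_\Omega\rho\,d\mu$ for all $\mu\in\mathcal M(\Omega)$. 4. If moreover for each compact $C\subseteq\Omega$ the function $x\mapsto\sup_{y\in C}|u_x(y)|$ vanishes at infinity on $\Omega$, then $\rho\in\mathcal C_0(\Omega)$; so $(L^+)^*\ell\in\mathcal C_0(\Omega)$. -/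

import Mathlib

open MeasureTheory TopologicalSpace
open scoped Distributions LineDeriv ZeroAtInfty

noncomputable section

namespace GreenOp

/-! ### Signed measures with the total variation norm -/

section Measures

variable {X : Type*} [MeasurableSpace X]

instance isFiniteMeasure_variation (μ : SignedMeasure X) :
    IsFiniteMeasure (VectorMeasure.variation μ) := by
  rw [← SignedMeasure.totalVariation_eq_variation]
  infer_instance

/-- The total variation norm `‖μ‖_TV = |μ|(X)` on the finite signed measures. -/
instance instNormSignedMeasure : Norm (SignedMeasure X) where
  norm μ := (VectorMeasure.variation μ Set.univ).toReal

theorem norm_signedMeasure_def (μ : SignedMeasure X) :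
    ‖μ‖ = (VectorMeasure.variation μ Set.univ).toReal := rfl

theorem normedSpaceCore_signedMeasure : NormedSpace.Core ℝ (SignedMeasure X) where
  norm_nonneg _ := ENNReal.toReal_nonneg
  norm_smul c μ := by
    simp only [norm_signedMeasure_def, VectorMeasure.variation_smul]
    simp [Measure.smul_apply]
  norm_triangle μ ν := by
    simp only [norm_signedMeasure_def]
    rw [← ENNReal.toReal_add (measure_ne_top _ _) (measure_ne_top _ _)]
    refine ENNReal.toReal_mono (by finiteness) ?_
    exact (VectorMeasure.variation_add_le (μ := μ) (ν := ν)) Set.univ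
  norm_eq_zero_iff μ := by
    rw [norm_signedMeasure_def, ENNReal.toReal_eq_zero_iff]
    simp

instance instNormedAddCommGroupSignedMeasure : NormedAddCommGroup (SignedMeasure X) :=
  NormedAddCommGroup.ofCore normedSpaceCore_signedMeasure

instance instNormedSpaceSignedMeasure : NormedSpace ℝ (SignedMeasure X) :=
  NormedSpace.ofCore normedSpaceCore_signedMeasure

theorem rnDeriv_facts (P N : Measure X) [IsFiniteMeasure P] [IsFiniteMeasure N] :
    Integrable (fun x ↦ (P.rnDeriv (P + N) x).toReal) (P + N) ∧
    Integrable (fun x ↦ (N.rnDeriv (P + N) x).toReal) (P + N) ∧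
    (∀ g : X → ℝ, ∫ x, g x * (P.rnDeriv (P + N) x).toReal ∂(P + N) = ∫ x, g x ∂P) ∧
    (∀ g : X → ℝ, ∫ x, g x * (N.rnDeriv (P + N) x).toReal ∂(P + N) = ∫ x, g x ∂N) ∧
    ((∀ᵐ x ∂(P + N), (P.rnDeriv (P + N) x).toReal = (N.rnDeriv (P + N) x).toReal) → P = N) := by
  have hPm : P ≪ P + N := Measure.AbsolutelyContinuous.add_right Measure.AbsolutelyContinuous.rfl N
  have hNm : N ≪ P + N := by
    rw [add_comm]; exact Measure.AbsolutelyContinuous.add_right Measure.AbsolutelyContinuous.rfl P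
  refine ⟨Measure.integrable_toReal_rnDeriv, Measure.integrable_toReal_rnDeriv,
    fun g ↦ ?_, fun g ↦ ?_, fun h ↦ ?_⟩
  · rw [← integral_rnDeriv_smul hPm]
    simp only [smul_eq_mul, mul_comm]
  · rw [← integral_rnDeriv_smul hNm]
    simp only [smul_eq_mul, mul_comm]
  · rw [← Measure.withDensity_rnDeriv_eq P (P + N) hPm]
    conv_rhs => rw [← Measure.withDensity_rnDeriv_eq N (P + N) hNm]
    refine withDensity_congr_ae ?_
    filter_upwards [h, Measure.rnDeriv_lt_top P (P + N), Measure.rnDeriv_lt_top N (P + N)]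
      with x hx h1 h2
    exact (ENNReal.toReal_eq_toReal_iff' h1.ne h2.ne).1 hx

end Measures

/-! ### Measures as functionals on test functions -/

variable {d : ℕ}

/-- The Banach space `𝓜(Ω)` of finite signed (Radon) measures on the open set `Ω ⊆ ℝᵈ`, with the
total variation norm. -/
abbrev RadonMeasure (Ω : Opens (EuclideanSpace ℝ (Fin d))) : Type := SignedMeasure Ω

variable {Ω K : Opens (EuclideanSpace ℝ (Fin d))} {n : ℕ∞}

theorem integrable_test (μ : RadonMeasure Ω) (φ : 𝓓^{n}(Ω, ℝ)) :
    VectorMeasure.Integrable μ (fun x : Ω ↦ φ x) := by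
  obtain ⟨C, hC⟩ := φ.continuous.bounded_above_of_compact_support φ.hasCompactSupport
  exact Integrable.of_bound (φ.continuous.comp continuous_subtype_val).aestronglyMeasurable C
    (Filter.Eventually.of_forall fun x ↦ hC x)

/-- The linear functional `φ ↦ ∫ φ dμ` on test functions. -/
def measureFunctional (n : ℕ∞) : RadonMeasure Ω →ₗ[ℝ] (𝓓^{n}(Ω, ℝ) →ₗ[ℝ] ℝ) where
  toFun μ :=
    { toFun φ := ∫ᵛ x : Ω, φ x ∂<•μ
      map_add' φ ψ := by
        exact VectorMeasure.integral_fun_add (integrable_test μ φ) (integrable_test μ ψ)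
      map_smul' c φ := by
        exact VectorMeasure.integral_fun_smul _ _ c _ }
  map_add' μ ν := by
    ext φ
    exact VectorMeasure.integral_add_vectorMeasure (integrable_test μ φ) (integrable_test ν φ)
  map_smul' c μ := by
    ext φ
    exact VectorMeasure.integral_smul_vectorMeasure _ c

theorem measureFunctional_apply (μ : RadonMeasure Ω) (φ : 𝓓^{n}(Ω, ℝ)) :
    measureFunctional n μ φ = ∫ᵛ x : Ω, φ x ∂<•μ := rfl

theorem eq_of_integral_test_eq (P N : Measure (EuclideanSpace ℝ (Fin d)))
    [IsFiniteMeasure P] [IsFiniteMeasure N] (hP : P (Ω : Set _)ᶜ = 0) (hN : N (Ω : Set _)ᶜ = 0)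
    (h : ∀ φ : 𝓓(Ω, ℝ), ∫ x, φ x ∂P = ∫ x, φ x ∂N) : P = N := by
  obtain ⟨hfP, hfN, hPg, hNg, hPN⟩ := rnDeriv_facts P N
  have key : ∀ᵐ x ∂(P + N), x ∈ (Ω : Set _) →
      (P.rnDeriv (P + N) x).toReal - (N.rnDeriv (P + N) x).toReal = 0 := by
    refine Ω.isOpen.ae_eq_zero_of_integral_contDiff_smul_eq_zero
      ((hfP.sub hfN).locallyIntegrable.locallyIntegrableOn _) fun g hg hgc hgs ↦ ?_
    have hφ := h ⟨g, hg, hgc, hgs⟩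
    change ∫ x, g x ∂P = ∫ x, g x ∂N at hφ
    rw [← hPg, ← hNg] at hφ
    obtain ⟨C, hC⟩ := hg.continuous.bounded_above_of_compact_support hgc
    have h1 : Integrable (fun x ↦ g x * (P.rnDeriv (P + N) x).toReal) (P + N) :=
      hfP.bdd_mul hg.continuous.aestronglyMeasurable (Filter.Eventually.of_forall hC)
    have h2 : Integrable (fun x ↦ g x * (N.rnDeriv (P + N) x).toReal) (P + N) :=
      hfN.bdd_mul hg.continuous.aestronglyMeasurable (Filter.Eventually.of_forall hC)
    simp only [smul_eq_mul, mul_sub]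
    rw [integral_sub h1 h2, sub_eq_zero]
    exact hφ
  have hΩ : ∀ᵐ x ∂(P + N), x ∈ (Ω : Set _) := by
    rw [ae_iff]
    have : {x | x ∉ (Ω : Set (EuclideanSpace ℝ (Fin d)))} = (Ω : Set _)ᶜ := rfl
    rw [this, Measure.add_apply, hP, hN, add_zero]
  exact hPN (by filter_upwards [key, hΩ] with x hx hxΩ using sub_eq_zero.1 (hx hxΩ))

/-- A finite signed measure on `Ω` is determined by its values on test functions. -/
theorem measureFunctional_injective :
    Function.Injective (measureFunctional (Ω := Ω) n) := by
  rw [← LinearMap.ker_eq_bot, LinearMap.ker_eq_bot']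
  intro μ hμ
  set P := μ.toJordanDecomposition.posPart with hP
  set N := μ.toJordanDecomposition.negPart with hN
  have hμPN : μ = P.toSignedMeasure - N.toSignedMeasure :=
    (SignedMeasure.toSignedMeasure_toJordanDecomposition μ).symm
  have hemb : MeasurableEmbedding (Subtype.val : Ω → EuclideanSpace ℝ (Fin d)) :=
    MeasurableEmbedding.subtype_coe Ω.isOpen.measurableSet
  have hnull : ∀ Q : Measure Ω, Q.map Subtype.val (Ω : Set (EuclideanSpace ℝ (Fin d)))ᶜ = 0 := by
    intro Q
    rw [hemb.map_apply]
    convert measure_empty (μ := Q)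
    ext x
    simp
  have hmap : P.map Subtype.val = N.map Subtype.val := by
    refine eq_of_integral_test_eq (Ω := Ω) _ _ (hnull P) (hnull N) fun φ ↦ ?_
    have h1 := DFunLike.congr_fun hμ
      (TestFunction.monoCLM ℝ φ : 𝓓^{n}(Ω, ℝ))
    rw [measureFunctional_apply, hμPN, VectorMeasure.integral_sub_vectorMeasure
      (integrable_test _ _) (integrable_test _ _)] at h1
    simp only [VectorMeasure.integral_toSignedMeasure, TestFunction.monoCLM_apply, le_top, le_refl,
      and_self, if_true, LinearMap.zero_apply, sub_eq_zero] at h1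
    rwa [hemb.integral_map, hemb.integral_map]
  have hPN : P = N := by
    rw [← hemb.comap_map P, ← hemb.comap_map N, hmap]
  rw [hμPN, sub_eq_zero]
  congr 1

/-! ### Distributions -/

/-- Lebesgue measure on the open set `Ω`. -/
instance instMeasureSpaceOpens (Ω : Opens (EuclideanSpace ℝ (Fin d))) : MeasureSpace Ω where
  volume := (volume : Measure (EuclideanSpace ℝ (Fin d))).comap Subtype.val

theorem integral_opens (f : EuclideanSpace ℝ (Fin d) → ℝ) :
    ∫ x : Ω, f x = ∫ x in (Ω : Set (EuclideanSpace ℝ (Fin d))), f x :=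
  integral_subtype_comap Ω.isOpen.measurableSet f

instance isFiniteMeasureOnCompacts_volume_opens :
    IsFiniteMeasureOnCompacts (volume : Measure Ω) :=
  IsFiniteMeasureOnCompacts.comap' _ continuous_subtype_val
    (MeasurableEmbedding.subtype_coe Ω.isOpen.measurableSet)

theorem hasCompactSupport_test (g : 𝓓^{n}(Ω, ℝ)) : HasCompactSupport (fun x : Ω ↦ g x) := by
  have hK : IsCompact ((Subtype.val : Ω → _) ⁻¹' tsupport g) :=
    Topology.IsInducing.subtypeVal.isCompact_preimage' g.hasCompactSupport
      (by rw [Subtype.range_coe]; exact g.tsupport_subset)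
  exact HasCompactSupport.intro hK fun x hx ↦ image_eq_zero_of_notMem_tsupport hx

theorem integrable_mul_test {f : Ω → ℝ} (hf : LocallyIntegrable f) (g : 𝓓^{n}(Ω, ℝ)) :
    Integrable (fun x : Ω ↦ f x * g x) := by
  have h := hf.integrable_smul_right_of_hasCompactSupport
    (g.continuous.comp continuous_subtype_val) (hasCompactSupport_test g)
  exact h

theorem integrable_continuous_mul_test (f : C(Ω, ℝ)) (g : 𝓓^{n}(Ω, ℝ)) :
    Integrable (fun x : Ω ↦ f x * g x) :=
  (f.continuous.mul (g.continuous.comp continuous_subtype_val)).integrable_of_hasCompactSupport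
    (hasCompactSupport_test g).mul_left

/-- A distribution, seen as a linear functional on test functions. -/
def functional : 𝓓'^{n}(Ω, ℝ) →ₗ[ℝ] (𝓓^{n}(Ω, ℝ) →ₗ[ℝ] ℝ) where
  toFun v :=
    { toFun φ := v φ
      map_add' φ ψ := map_add v φ ψ
      map_smul' c φ := map_smul v c φ }
  map_add' _ _ := rfl
  map_smul' _ _ := rfl

/-- The distribution `φ ↦ ∫_Ω f φ dx` given by a continuous function `f` on `Ω`. -/
def ofContinuous (n : ℕ∞) (f : C(Ω, ℝ)) : 𝓓'^{n}(Ω, ℝ) where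
  toFun φ := ∫ x : Ω, f x * φ x
  map_add' φ ψ := by
    rw [← integral_add (integrable_continuous_mul_test f φ) (integrable_continuous_mul_test f ψ)]
    exact integral_congr_ae (Filter.Eventually.of_forall fun x ↦ mul_add (f x) (φ x) (ψ x))
  map_smul' c φ := by
    rw [RingHom.id_apply, ← integral_smul]
    exact integral_congr_ae (Filter.Eventually.of_forall fun x ↦ mul_left_comm (f x) c (φ x))
  cont := by
    let F : EuclideanSpace ℝ (Fin d) → ℝ := Function.extend Subtype.val f 0
    have hF : ∀ x : Ω, F x = f x := fun x ↦ Subtype.val_injective.extend_apply f 0 x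
    have hc : ContinuousOn F (Ω : Set (EuclideanSpace ℝ (Fin d))) := by
      rw [continuousOn_iff_continuous_domRestrict]
      exact f.continuous.congr fun x ↦ (hF x).symm
    have hl : LocallyIntegrableOn F (Ω : Set (EuclideanSpace ℝ (Fin d))) :=
      hc.locallyIntegrableOn Ω.isOpen.measurableSet
    convert (TestFunction.integralAgainstBilinCLM (n := n) (Ω := Ω)
      (ContinuousLinearMap.mul ℝ ℝ) volume F).continuous using 1
    ext φ
    rw [TestFunction.integralAgainstBilinCLM_eq_integral hl]
    rw [← setIntegral_eq_integral_of_forall_compl_eq_zero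
      (s := (Ω : Set (EuclideanSpace ℝ (Fin d)))), ← integral_opens]
    · refine integral_congr_ae (Filter.Eventually.of_forall fun x ↦ ?_)
      simp [hF, mul_comm]
    · intro x hx
      have : φ x = 0 := image_eq_zero_of_notMem_tsupport fun h ↦ hx (φ.tsupport_subset h)
      simp [this]

theorem ofContinuous_apply (f : C(Ω, ℝ)) (φ : 𝓓^{n}(Ω, ℝ)) :
    ofContinuous n f φ = ∫ x : Ω, f x * φ x := rfl

/-- The restriction to the open set `K ⊆ Ω` of a distribution on `Ω`. -/
def restrict (K : Opens (EuclideanSpace ℝ (Fin d))) :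
    𝓓'^{n}(Ω, ℝ) →L[ℝ] 𝓓'^{n}(K, ℝ) :=
  (TestFunction.monoCLM ℝ).precompCompactConvergenceCLM ℝ

/-! ### Differential operators -/

/-- The multi-indices `α ∈ ℕᵈ` with `|α| ≤ N`. -/
def multiIndices (d N : ℕ) : Finset (Fin d → ℕ) :=
  (Fintype.piFinset fun _ ↦ Finset.range (N + 1)).filter fun α ↦ ∑ i, α i ≤ N

theorem mem_multiIndices {N : ℕ} {α : Fin d → ℕ} :
    α ∈ multiIndices d N ↔ ∑ i, α i ≤ N := by
  simp only [multiIndices, Finset.mem_filter, Fintype.mem_piFinset, Finset.mem_range,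
    and_iff_right_iff_imp]
  exact fun h i ↦ Nat.lt_succ_of_le
    ((Finset.single_le_sum (fun j _ ↦ Nat.zero_le (α j)) (Finset.mem_univ i)).trans h)

/-- The partial derivative `D^α = ∂₁^α₁ ⋯ ∂_d^α_d` on test functions. -/
def partialDeriv (α : Fin d → ℕ) : 𝓓(Ω, ℝ) →L[ℝ] 𝓓(Ω, ℝ) :=
  (List.ofFn fun i : Fin d ↦
    LineDeriv.lineDerivOpCLM ℝ 𝓓(Ω, ℝ) (EuclideanSpace.single i (1 : ℝ)) ^ α i).prod

/-- A linear differential operator `P(D) = ∑_{|α| ≤ N} p_α D^α` with measurable coefficients on `Ω`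
which acts by transposition on the distributions of order at most `n` (all distributions if
`n = ⊤`): for every test function `φ`, the formal adjoint
`P(D)^* φ = ∑_{|α| ≤ N} (-1)^|α| D^α (p_α φ)`, defined weakly by
`∫_Ω (P(D) ψ) φ dx = ∫_Ω ψ (P(D)^* φ) dx` for all test functions `ψ`, is a compactly supported
function of class `C^n` on `Ω`. Smooth coefficients are admissible for every `n`, and
coefficients `p_α ∈ C^{|α|}` for `n = 0`. -/
structure DiffOp (Ω : Opens (EuclideanSpace ℝ (Fin d))) (n : ℕ∞) where
  order : ℕ
  coeff : (Fin d → ℕ) → Ω → ℝ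
  measurable_coeff : ∀ α, Measurable (coeff α)
  locallyIntegrable_coeff : ∀ α, LocallyIntegrable (coeff α)
  exists_adjoint : ∀ φ : 𝓓(Ω, ℝ), ∃ g : 𝓓^{n}(Ω, ℝ), ∀ ψ : 𝓓(Ω, ℝ),
    ∫ x : Ω, (∑ α ∈ multiIndices d order, coeff α x * partialDeriv α ψ x) * φ x =
      ∫ x : Ω, ψ x * g x

theorem eq_of_integral_mul_test_eq {g g' : 𝓓^{n}(Ω, ℝ)}
    (h : ∀ ψ : 𝓓(Ω, ℝ), ∫ x : Ω, ψ x * g x = ∫ x : Ω, ψ x * g' x) : g = g' := by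
  have hsupp : ∀ (g : 𝓓^{n}(Ω, ℝ)) (x), x ∉ (Ω : Set _) → g x = 0 := fun g x hx ↦
    image_eq_zero_of_notMem_tsupport fun h ↦ hx (g.tsupport_subset h)
  have hint : ∀ (ψ : 𝓓(Ω, ℝ)) (g : 𝓓^{n}(Ω, ℝ)), Integrable (fun x ↦ ψ x * g x) := fun ψ g ↦
    (ψ.continuous.mul g.continuous).integrable_of_hasCompactSupport g.hasCompactSupport.mul_left
  have hfull : ∀ (ψ : 𝓓(Ω, ℝ)) (g : 𝓓^{n}(Ω, ℝ)), ∫ x : Ω, ψ x * g x = ∫ x, ψ x * g x := by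
    intro ψ g
    rw [integral_opens (Ω := Ω) (fun x ↦ ψ x * g x)]
    exact setIntegral_eq_integral_of_forall_compl_eq_zero fun x hx ↦ by rw [hsupp g x hx, mul_zero]
  have hae : ∀ᵐ x, x ∈ (Ω : Set _) → g x - g' x = 0 := by
    refine Ω.isOpen.ae_eq_zero_of_integral_contDiff_smul_eq_zero
      ((g.continuous.sub g'.continuous).locallyIntegrable.locallyIntegrableOn _) fun ψ hψ hc hs ↦ ?_
    have h1 := h ⟨ψ, hψ, hc, hs⟩
    have i1 := hint ⟨ψ, hψ, hc, hs⟩ g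
    have i2 := hint ⟨ψ, hψ, hc, hs⟩ g'
    rw [hfull, hfull, ← sub_eq_zero, ← integral_sub i1 i2] at h1
    simp only [smul_eq_mul, mul_sub]
    exact h1
  have hae' : (fun x ↦ g x) =ᵐ[volume] (fun x ↦ g' x) := by
    filter_upwards [hae] with x hx
    by_cases hxΩ : x ∈ (Ω : Set (EuclideanSpace ℝ (Fin d)))
    · exact sub_eq_zero.1 (hx hxΩ)
    · rw [hsupp g x hxΩ, hsupp g' x hxΩ]
  ext x
  exact congrFun ((Continuous.ae_eq_iff_eq volume g.continuous g'.continuous).1 hae') x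

namespace DiffOp

variable (P : DiffOp Ω n)

/-- The function `P(D) ψ = ∑_{|α| ≤ N} p_α D^α ψ` for a test function `ψ`. -/
def onTest (ψ : 𝓓(Ω, ℝ)) (x : Ω) : ℝ :=
  ∑ α ∈ multiIndices d P.order, P.coeff α x * partialDeriv α ψ x

theorem locallyIntegrable_onTest (ψ : 𝓓(Ω, ℝ)) : LocallyIntegrable (P.onTest ψ) := by
  have h : Integrable (P.onTest ψ) := integrable_finsetSum _ fun α _ ↦
    integrable_mul_test (P.locallyIntegrable_coeff α) _
  exact h.locallyIntegrable

/-- The formal adjoint `φ ↦ P(D)^* φ`. -/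
def adjoint : 𝓓(Ω, ℝ) →ₗ[ℝ] 𝓓^{n}(Ω, ℝ) where
  toFun φ := (P.exists_adjoint φ).choose
  map_add' φ φ' := by
    refine eq_of_integral_mul_test_eq fun ψ ↦ ?_
    have hi : ∀ g : 𝓓^{n}(Ω, ℝ), Integrable (fun x : Ω ↦ ψ x * g x) := fun g ↦
      integrable_continuous_mul_test ⟨fun x : Ω ↦ ψ x, ψ.continuous.comp continuous_subtype_val⟩ g
    rw [← (P.exists_adjoint (φ + φ')).choose_spec ψ]
    have e : ∀ g g' : 𝓓^{n}(Ω, ℝ), ∫ x : Ω, ψ x * (g + g') x =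
        (∫ x : Ω, ψ x * g x) + ∫ x : Ω, ψ x * g' x := fun g g' ↦ by
      rw [← integral_add (hi g) (hi g')]
      exact integral_congr_ae (Filter.Eventually.of_forall fun x ↦ mul_add _ (g x) (g' x))
    rw [e, ← (P.exists_adjoint φ).choose_spec ψ, ← (P.exists_adjoint φ').choose_spec ψ]
    have h := P.locallyIntegrable_onTest ψ
    refine Eq.trans ?_ (integral_add (integrable_mul_test h φ) (integrable_mul_test h φ'))
    exact integral_congr_ae (Filter.Eventually.of_forall fun x ↦ mul_add _ (φ x) (φ' x))
  map_smul' c φ := by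
    refine eq_of_integral_mul_test_eq fun ψ ↦ ?_
    rw [← (P.exists_adjoint (c • φ)).choose_spec ψ]
    have e : ∀ g : 𝓓^{n}(Ω, ℝ), ∫ x : Ω, ψ x * (c • g) x = c * ∫ x : Ω, ψ x * g x := fun g ↦ by
      rw [← integral_const_mul]
      exact integral_congr_ae (Filter.Eventually.of_forall fun x ↦ mul_left_comm _ c (g x))
    rw [RingHom.id_apply, e, ← (P.exists_adjoint φ).choose_spec ψ, ← integral_const_mul]
    exact integral_congr_ae (Filter.Eventually.of_forall fun x ↦ mul_left_comm _ c (φ x))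

theorem integral_adjoint (φ ψ : 𝓓(Ω, ℝ)) :
    ∫ x : Ω, P.onTest ψ x * φ x = ∫ x : Ω, ψ x * P.adjoint φ x :=
  (P.exists_adjoint φ).choose_spec ψ

/-- The action of `P(D)` on distributions: `⟨P(D) v, φ⟩ = ⟨v, P(D)^* φ⟩`. -/
def apply : 𝓓'^{n}(Ω, ℝ) →ₗ[ℝ] (𝓓(Ω, ℝ) →ₗ[ℝ] ℝ) :=
  (LinearMap.lcomp ℝ ℝ P.adjoint) ∘ₗ functional

theorem apply_apply (v : 𝓓'^{n}(Ω, ℝ)) (φ : 𝓓(Ω, ℝ)) : P.apply v φ = v (P.adjoint φ) := rfl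

/-! ### The space `𝓑_P` -/

/-- `𝓑_P = {v | P(D) v ∈ 𝓜(Ω), v|_K ∈ 𝓜(K)}` as a space of distributions on `Ω`. -/
def nativeSubmodule (K : Opens (EuclideanSpace ℝ (Fin d))) : Submodule ℝ 𝓓'^{n}(Ω, ℝ) where
  carrier := {v | (∃ μ : RadonMeasure Ω, P.apply v = measureFunctional ⊤ μ) ∧
    ∃ ν : RadonMeasure K, functional (restrict K v) = measureFunctional n ν}
  zero_mem' := ⟨⟨0, by simp⟩, ⟨0, by simp⟩⟩
  add_mem' := by
    rintro v w ⟨⟨μ, hμ⟩, ⟨ν, hν⟩⟩ ⟨⟨μ', hμ'⟩, ⟨ν', hν'⟩⟩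
    exact ⟨⟨μ + μ', by simp [hμ, hμ']⟩, ⟨ν + ν', by simp [hν, hν']⟩⟩
  smul_mem' := by
    rintro c v ⟨⟨μ, hμ⟩, ⟨ν, hν⟩⟩
    exact ⟨⟨c • μ, by simp [hμ]⟩, ⟨c • ν, by simp [hν]⟩⟩

/-- The space `𝓑_P`; a type of its own, because it does not carry the topology of distributions. -/
def NativeSpace (K : Opens (EuclideanSpace ℝ (Fin d))) : Type := P.nativeSubmodule K

namespace NativeSpace

variable {P}

instance : AddCommGroup (P.NativeSpace K) := inferInstanceAs (AddCommGroup (P.nativeSubmodule K))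

instance : Module ℝ (P.NativeSpace K) := inferInstanceAs (Module ℝ (P.nativeSubmodule K))

/-- The distribution underlying an element of `𝓑_P`. -/
def distr : P.NativeSpace K →ₗ[ℝ] 𝓓'^{n}(Ω, ℝ) := (P.nativeSubmodule K).subtype

/-- The unique measure `μ` with `P(D) v = μ`. -/
def opₗ : P.NativeSpace K →ₗ[ℝ] RadonMeasure Ω where
  toFun v := v.2.1.choose
  map_add' v w := by
    refine measureFunctional_injective (n := ⊤) ?_
    rw [map_add, ← v.2.1.choose_spec, ← w.2.1.choose_spec, ← (v + w).2.1.choose_spec, ← map_add]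
    rfl
  map_smul' c v := by
    refine measureFunctional_injective (n := ⊤) ?_
    rw [map_smul, ← v.2.1.choose_spec, ← (c • v).2.1.choose_spec, ← map_smul]
    rfl

theorem measureFunctional_opₗ (v : P.NativeSpace K) :
    measureFunctional ⊤ (opₗ v) = P.apply (distr v) :=
  v.2.1.choose_spec.symm

/-- The unique measure `ν` on `K` with `v|_K = ν`. -/
def resₗ : P.NativeSpace K →ₗ[ℝ] RadonMeasure K where
  toFun v := v.2.2.choose
  map_add' v w := by
    refine measureFunctional_injective (n := n) ?_
    rw [map_add, ← v.2.2.choose_spec, ← w.2.2.choose_spec, ← (v + w).2.2.choose_spec, ← map_add,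
      ← map_add]
    rfl
  map_smul' c v := by
    refine measureFunctional_injective (n := n) ?_
    rw [map_smul, ← v.2.2.choose_spec, ← (c • v).2.2.choose_spec, ← map_smul, RingHom.id_apply,
      ← map_smul]
    rfl

theorem measureFunctional_resₗ (v : P.NativeSpace K) :
    measureFunctional n (resₗ v) = functional (restrict K (distr v)) :=
  v.2.2.choose_spec.symm

/-- `‖v‖ = ‖P(D) v‖_TV + ‖v|_K‖_TV`. This is a norm as soon as `v = 0` is the only distribution
with `P(D) v = 0` and `v|_K = 0`. -/
def nativeSeminorm : Seminorm ℝ (P.NativeSpace K) :=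
  (normSeminorm ℝ (RadonMeasure Ω)).comp opₗ + (normSeminorm ℝ (RadonMeasure K)).comp resₗ

instance : SeminormedAddCommGroup (P.NativeSpace K) :=
  nativeSeminorm.toAddGroupSeminorm.toSeminormedAddCommGroup

theorem norm_def (v : P.NativeSpace K) : ‖v‖ = ‖opₗ v‖ + ‖resₗ v‖ := rfl

instance : NormedSpace ℝ (P.NativeSpace K) where
  norm_smul_le c v := (map_smul_eq_mul nativeSeminorm c v).le

/-- The operator `L = P(D) : 𝓑_P → 𝓜(Ω)`. -/
def op (P : DiffOp Ω n) (K : Opens (EuclideanSpace ℝ (Fin d))) :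
    P.NativeSpace K →L[ℝ] RadonMeasure Ω :=
  opₗ.mkContinuous 1 fun v ↦ by
    rw [norm_def, one_mul]
    exact le_add_of_nonneg_right (norm_nonneg _)

end NativeSpace

/-- Unique continuation from `K`: a solution of `P(D) v = 0` in `Ω` is determined by its restriction
to `K`. -/
def UniqueContinuation (P : DiffOp Ω n) (K : Opens (EuclideanSpace ℝ (Fin d))) : Prop :=
  ∀ v w : 𝓓'^{n}(Ω, ℝ), P.apply v = 0 → P.apply w = 0 → restrict K v = restrict K w → v = w

/-- The Green function hypothesis: `x ↦ u_x` is a continuous map from `Ω` to `C(Ω)` with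
`sup_x ‖u_x‖_∞ < ∞`, and `P(D) u_x = δ_x` for all `x`. (Continuity for uniform convergence on
compact sets, the topology of `C(Ω, ℝ)`, is all that is required.) -/
structure IsGreenFunction (u : Ω → C(Ω, ℝ)) : Prop where
  continuous : Continuous u
  bounded : ∃ M : ℝ, ∀ x y, |u x y| ≤ M
  solves : ∀ (x : Ω) (φ : 𝓓(Ω, ℝ)), P.apply (ofContinuous n (u x)) φ = φ x

end DiffOp

/-- `T : Ω → C(Ω)` vanishes at infinity on compact sets: for each compact `C ⊆ Ω`, the function
`x ↦ sup_{y ∈ C} |T(x)(y)|` vanishes at infinity. -/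
def VanishesOnCompacts (T : Ω → C(Ω, ℝ)) : Prop :=
  ∀ C : Set Ω, IsCompact C →
    Filter.Tendsto (fun x ↦ sSup ((fun y ↦ |T x y|) '' C)) (Filter.cocompact Ω) (nhds 0)

/-! ### The structural assumptions and the pseudoinverse -/

section Pseudoinverse

variable {B M : Type*} [SeminormedAddCommGroup B] [NormedSpace ℝ B] [SeminormedAddCommGroup M]
  [NormedSpace ℝ M]

/-- `ker L` has a closed complement, and `ran L` is closed and has a closed complement. -/
structure StructuralAssumption (L : B →L[ℝ] M) : Prop where
  ker_complement : ∃ V : Submodule ℝ B, IsClosed (V : Set B) ∧ IsCompl V L.toLinearMap.ker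
  range_closed : IsClosed (L.toLinearMap.range : Set M)
  range_complement : ∃ W : Submodule ℝ M, IsClosed (W : Set M) ∧ IsCompl L.toLinearMap.range W

/-- The pseudoinverse `L⁺ = j_V ∘ (L|_V)⁻¹ ∘ Π_{ran L}` of `L`, where `V` is a complement of `ker L`
and `Π_{ran L}` is the projection onto `ran L` along its complement `W`. -/
def pseudoinverse (L : B →ₗ[ℝ] M) {V : Submodule ℝ B} (hV : IsCompl V L.ker)
    {W : Submodule ℝ M} (hW : IsCompl L.range W) : M →ₗ[ℝ] B :=
  V.subtype ∘ₗ (L.kerComplementEquivRange hV).symm.toLinearMap ∘ₗ L.range.projectionOnto W hW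

end Pseudoinverse

/-- The functional `ℓ` on `𝓑_P` is of the form `⟨ℓ, v⟩ = ∫_Ω a(x) v(x) dx`; this is only asked for
those `v ∈ 𝓑_P` that are bounded continuous functions, where the integral always makes sense. -/
def IsIntegration (P : DiffOp Ω n) (a : Ω → ℝ) (ℓ : P.NativeSpace K →L[ℝ] ℝ) : Prop :=
  ∀ (v : P.NativeSpace K) (f : C(Ω, ℝ)), (∃ M : ℝ, ∀ x, |f x| ≤ M) →
    DiffOp.NativeSpace.distr v = ofContinuous n f → ℓ v = ∫ x : Ω, a x * f x

end GreenOp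

end

/-!
The operator `L = P(D)` has an explicit bounded right inverse, the Green operator
`G μ = ∫ u_y dμ(y)`, and everything follows from its existence.

* The potential `x ↦ ∫ u_y(x) dμ(y)` is continuous by dominated convergence and bounded by
  `M ‖μ‖`, where `M = sup |u_y(x)|`.
* Fubini's theorem for the signed measure `μ` (`fubini_signedMeasure`) gives
  `∫ a(y) (G μ)(y) dy = ∫ ρ dμ` for integrable `a`, with `ρ(x) = ∫ u_x(y) a(y) dy`. For
  `a = P(D)^* φ` the hypothesis `P(D) u_x = δ_x` says that `ρ = φ`, so `P(D) (G μ) = μ`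
  (`DiffOp.IsGreenFunction.apply_potential`). For general `a` it identifies the adjoint of `G`.
* Since `K` is bounded, the restriction of `G μ` to `K` is the measure with the bounded density
  `G μ`, whose total variation is at most `M ‖μ‖ |K|`. Hence `G` maps `𝓜(Ω)` boundedly into `𝓑_P`
  (`DiffOp.greenOp`), and `L G = 1`.

A bounded right inverse makes `L` surjective, and `V = ran G` is a complement of `ker L`. The
subspace `V = ker (1 - G L)` is closed because unique continuation from `K` makes `𝓑_P` a
Hausdorff space. With `W = 0`, the pseudoinverse belonging to `V` and `W` is `G`. Finally, for
every `y` the function `x ↦ u_x(y)` vanishes at infinity under the last hypothesis, so `ρ` does by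
dominated convergence, the filter of neighbourhoods of infinity of `Ω` being countably generated.
-/

noncomputable section

namespace GreenOp

/-! ### Integration against signed measures -/

section Signed

variable {X Y : Type*} [MeasurableSpace X] [MeasurableSpace Y]

theorem norm_integral_signedMeasure_le (μ : SignedMeasure X) {f : X → ℝ} {M : ℝ}
    (hf : ∀ x, |f x| ≤ M) : |∫ᵛ x, f x ∂<•μ| ≤ M * ‖μ‖ := by
  rcases isEmpty_or_nonempty X with hX | ⟨⟨x₀⟩⟩
  · have : μ = 0 := VectorMeasure.eq_zero_of_isEmpty μ
    simp [this]
  have hM : 0 ≤ M := (abs_nonneg _).trans (hf x₀)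
  refine (VectorMeasure.norm_integral_le_of_norm_le_const (μ := μ) (f := f) (C := M)
    (B := (ContinuousLinearMap.lsmul ℝ ℝ).flip) (Filter.Eventually.of_forall hf)).trans ?_
  have hB : ‖(ContinuousLinearMap.lsmul ℝ ℝ : ℝ →L[ℝ] ℝ →L[ℝ] ℝ).flip‖ ≤ 1 := by
    rw [ContinuousLinearMap.opNorm_flip]
    exact ContinuousLinearMap.opNorm_lsmul_le
  have h := mul_le_mul_of_nonneg_left hB hM
  rw [mul_one] at h
  exact mul_le_mul_of_nonneg_right h (norm_nonneg μ)

/-- The integral against a signed measure in terms of its Jordan decomposition. -/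
theorem integral_signedMeasure_eq_sub (μ : SignedMeasure X) {f : X → ℝ}
    (hf : VectorMeasure.Integrable μ f) :
    Integrable f μ.toJordanDecomposition.posPart ∧ Integrable f μ.toJordanDecomposition.negPart ∧
    ∫ᵛ x, f x ∂<•μ = ∫ x, f x ∂μ.toJordanDecomposition.posPart -
      ∫ x, f x ∂μ.toJordanDecomposition.negPart := by
  have hf' := hf
  rw [VectorMeasure.Integrable, ← SignedMeasure.totalVariation_eq_variation,
    SignedMeasure.totalVariation, integrable_add_measure] at hf'
  refine ⟨hf'.1, hf'.2, ?_⟩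
  conv_lhs => rw [← SignedMeasure.toSignedMeasure_toJordanDecomposition μ]
  rw [JordanDecomposition.toSignedMeasure, VectorMeasure.integral_sub_vectorMeasure,
    VectorMeasure.integral_toSignedMeasure, VectorMeasure.integral_toSignedMeasure]
  · simpa [VectorMeasure.Integrable] using hf'.1
  · simpa [VectorMeasure.Integrable] using hf'.2

/-- The integral against the signed measure `f ν`. -/
theorem integral_withDensityᵥ {ν : Measure X} {f g : X → ℝ} (hf : Integrable f ν)
    (hg : VectorMeasure.Integrable (ν.withDensityᵥ f) g) :
    ∫ᵛ x, g x ∂<•(ν.withDensityᵥ f) = ∫ x, f x * g x ∂ν := by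
  -- used for `h = f` and `h = -f`, the two parts of `f ν` having the densities `f⁺` and `f⁻`
  have key : ∀ h : X → ℝ, Integrable h ν → (∀ x, ENNReal.ofReal (h x) ≤ ‖f x‖ₑ) →
      Integrable g (ν.withDensity fun x ↦ ENNReal.ofReal (h x)) ∧
      Integrable (fun x ↦ (ENNReal.ofReal (h x)).toReal * g x) ν ∧
      ∫ x, g x ∂(ν.withDensity fun x ↦ ENNReal.ofReal (h x)) =
        ∫ x, (ENNReal.ofReal (h x)).toReal * g x ∂ν := fun h hh hle ↦ by
    have hm : AEMeasurable (fun x ↦ ENNReal.ofReal (h x)) ν := hh.aemeasurable.ennreal_ofReal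
    have hlt : ∀ᵐ x ∂ν, ENNReal.ofReal (h x) < ⊤ :=
      Filter.Eventually.of_forall fun x ↦ ENNReal.ofReal_lt_top
    have h1 : Integrable g (ν.withDensity fun x ↦ ENNReal.ofReal (h x)) := by
      rw [VectorMeasure.Integrable, Measure.variation_withDensityᵥ hf] at hg
      exact hg.mono_measure (withDensity_mono (Filter.Eventually.of_forall hle))
    exact ⟨h1, (integrable_withDensity_iff_integrable_smul₀' hm hlt).1 h1,
      integral_withDensity_eq_integral_toReal_smul₀ hm hlt g⟩
  obtain ⟨p1, p2, p3⟩ := key f hf fun x ↦ Real.ofReal_le_enorm _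
  obtain ⟨q1, q2, q3⟩ := key (-f) hf.neg fun x ↦ by
    simpa using Real.ofReal_le_enorm (-f x)
  have i1 := isFiniteMeasure_withDensity_ofReal hf.2
  have i2 := isFiniteMeasure_withDensity_ofReal hf.neg.2
  rw [withDensityᵥ_eq_withDensity_pos_part_sub_withDensity_neg_part hf]
  refine (VectorMeasure.integral_sub_vectorMeasure ?_ ?_).trans ?_
  · simpa only [VectorMeasure.Integrable, Measure.variation_toSignedMeasure] using p1
  · simpa only [VectorMeasure.Integrable, Measure.variation_toSignedMeasure] using! q1
  refine (congrArg₂ _ (VectorMeasure.integral_toSignedMeasure.trans p3)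
    (VectorMeasure.integral_toSignedMeasure.trans q3)).trans ?_
  rw [← integral_sub p2 q2]
  refine integral_congr_ae (Filter.Eventually.of_forall fun x ↦ ?_)
  simp only [Pi.neg_apply, ENNReal.toReal_ofReal', ← sub_mul]
  rw [max_zero_sub_max_neg_zero_eq_self]

/-- Fubini's theorem for a signed measure `μ` and a measure `a ν` with an integrable density `a`, for
a bounded kernel `k`. -/
theorem fubini_signedMeasure (μ : SignedMeasure X) {ν : Measure Y} [SFinite ν] {k : X → Y → ℝ}
    (hk : StronglyMeasurable k.uncurry) {M : ℝ} (hM : ∀ x y, |k x y| ≤ M) {a : Y → ℝ}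
    (ha : Integrable a ν) :
    VectorMeasure.Integrable μ (fun x ↦ ∫ y, k x y * a y ∂ν) ∧
    Integrable (fun y ↦ a y * ∫ᵛ x, k x y ∂<•μ) ν ∧
    ∫ y, a y * (∫ᵛ x, k x y ∂<•μ) ∂ν = ∫ᵛ x, (∫ y, k x y * a y ∂ν) ∂<•μ := by
  have hprod : ∀ (ρ : Measure X) [IsFiniteMeasure ρ],
      Integrable (fun p : X × Y ↦ k p.1 p.2 * a p.2) (ρ.prod ν) := fun ρ _ ↦ by
    refine Integrable.bdd_mul (ha.comp_snd ρ) hk.aestronglyMeasurable (c := M)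
      (Filter.Eventually.of_forall fun p ↦ hM p.1 p.2)
  have hslice : ∀ y, VectorMeasure.Integrable μ (fun x ↦ k x y) := fun y ↦
    Integrable.of_bound (hk.comp_measurable measurable_prodMk_right).aestronglyMeasurable M
      (Filter.Eventually.of_forall fun x ↦ hM x y)
  have hint : VectorMeasure.Integrable μ (fun x ↦ ∫ y, k x y * a y ∂ν) :=
    (hprod _).integral_prod_left
  set p := μ.toJordanDecomposition.posPart
  set q := μ.toJordanDecomposition.negPart
  have hsw : ∀ (ρ : Measure X) [IsFiniteMeasure ρ],
      Integrable (fun y ↦ a y * ∫ x, k x y ∂ρ) ν ∧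
      ∫ y, a y * (∫ x, k x y ∂ρ) ∂ν = ∫ x, (∫ y, k x y * a y ∂ν) ∂ρ := fun ρ _ ↦ by
    have e : ∀ y, ∫ x, k x y * a y ∂ρ = a y * ∫ x, k x y ∂ρ := fun y ↦ by
      rw [integral_mul_const, mul_comm]
    have h := (hprod ρ).integral_prod_right
    simp only [e] at h
    refine ⟨h, ?_⟩
    rw [integral_integral_swap (hprod ρ)]
    simp only [e]
  have e : ∀ y, a y * ∫ᵛ x, k x y ∂<•μ = a y * ∫ x, k x y ∂p - a y * ∫ x, k x y ∂q := fun y ↦ by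
    rw [(integral_signedMeasure_eq_sub μ (hslice y)).2.2, mul_sub]
  simp only [e]
  refine ⟨hint, (hsw p).1.sub (hsw q).1, ?_⟩
  rw [integral_sub (hsw p).1 (hsw q).1, (hsw p).2, (hsw q).2,
    (integral_signedMeasure_eq_sub μ hint).2.2]

end Signed

/-! ### Open subsets of Euclidean space -/

theorem isCountablyGenerated_cocompact (X : Type*) [TopologicalSpace X] [SigmaCompactSpace X]
    [WeaklyLocallyCompactSpace X] : (Filter.cocompact X).IsCountablyGenerated := by
  let K : CompactExhaustion X := default
  have h : (Filter.cocompact X).HasBasis (fun _ : ℕ ↦ True) fun n ↦ (K n)ᶜ :=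
    Filter.hasBasis_cocompact.to_hasBasis
      (fun C hC ↦ by
        obtain ⟨n, hn⟩ := K.exists_superset_of_isCompact hC
        exact ⟨n, trivial, Set.compl_subset_compl.2 hn⟩)
      fun n _ ↦ ⟨K n, K.isCompact n, subset_rfl⟩
  exact h.isCountablyGenerated

variable {d : ℕ} {Ω K : Opens (EuclideanSpace ℝ (Fin d))} {n : ℕ∞}

instance locallyCompactSpace_opens : LocallyCompactSpace Ω := Ω.isOpen.locallyCompactSpace

/-- Restriction of continuous functions agrees with restriction of distributions. -/
theorem ofContinuous_restrict (hKΩ : K ≤ Ω) (f : C(Ω, ℝ)) :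
    restrict K (ofContinuous n f) =
      ofContinuous n (f.comp ⟨Set.inclusion hKΩ, continuous_inclusion hKΩ⟩) := by
  ext φ
  have hφ : ∀ x ∉ (K : Set (EuclideanSpace ℝ (Fin d))), φ x = 0 := fun x hx ↦
    image_eq_zero_of_notMem_tsupport fun h ↦ hx (φ.tsupport_subset h)
  -- the extension of `f` by zero turns both sides into integrals over the whole space
  let F : EuclideanSpace ℝ (Fin d) → ℝ := Function.extend Subtype.val f 0
  have hF : ∀ x : Ω, F x = f x := fun x ↦ Subtype.val_injective.extend_apply f 0 x
  have hfull : ∀ U : Opens (EuclideanSpace ℝ (Fin d)), K ≤ U →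
      ∫ x : U, F x * φ x = ∫ x, F x * φ x := fun U hU ↦ by
    rw [integral_opens (Ω := U) (fun x ↦ F x * φ x)]
    exact setIntegral_eq_integral_of_forall_compl_eq_zero fun x hx ↦ by
      rw [hφ x fun h ↦ hx (hU h), mul_zero]
  have hr : restrict K (ofContinuous n f) φ = ∫ x : Ω, F x * φ x := by
    change ∫ x : Ω, f x * (TestFunction.monoCLM ℝ φ : 𝓓^{n}(Ω, ℝ)) x = _
    simp only [TestFunction.monoCLM_apply, le_refl, hKΩ, and_self, if_true, hF]
  rw [hr, hfull Ω hKΩ, ← hfull K le_rfl]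
  refine integral_congr_ae (Filter.Eventually.of_forall fun x ↦ ?_)
  exact congrArg (· * φ x) (hF ⟨x, hKΩ x.2⟩)

theorem isFiniteMeasure_volume_opens
    (hK : Bornology.IsBounded (K : Set (EuclideanSpace ℝ (Fin d)))) :
    IsFiniteMeasure (volume : Measure K) := by
  refine ⟨?_⟩
  have : (volume : Measure K) Set.univ = volume (K : Set (EuclideanSpace ℝ (Fin d))) := by
    change Measure.comap (Subtype.val : K → EuclideanSpace ℝ (Fin d)) volume Set.univ = _
    refine ((MeasurableEmbedding.subtype_coe K.isOpen.measurableSet).comap_apply _ _).trans ?_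
    rw [Set.image_univ, Subtype.range_coe]
  rw [this]
  exact hK.measure_lt_top

/-! ### Operators with a right inverse -/

section Pseudoinverse

variable {B M : Type*} [SeminormedAddCommGroup B] [NormedSpace ℝ B] [SeminormedAddCommGroup M]
  [NormedSpace ℝ M]

theorem isCompl_range_ker_of_rightInverse {L : B →ₗ[ℝ] M} {G : M →ₗ[ℝ] B}
    (h : ∀ x, L (G x) = x) : IsCompl G.range L.ker := by
  refine ⟨?_, ?_⟩
  · rw [Submodule.disjoint_def]
    rintro _ ⟨x, rfl⟩ hx
    rw [LinearMap.mem_ker, h] at hx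
    rw [hx, map_zero]
  · rw [codisjoint_iff_le_sup]
    intro v _
    refine Submodule.mem_sup.2 ⟨G (L v), ⟨_, rfl⟩, v - G (L v), ?_, add_sub_cancel _ _⟩
    rw [LinearMap.mem_ker, map_sub, h, sub_self]

theorem pseudoinverse_eq_of_rightInverse {L : B →ₗ[ℝ] M} {G : M →ₗ[ℝ] B}
    (h : ∀ x, L (G x) = x) (hV : IsCompl G.range L.ker) {W : Submodule ℝ M}
    (hW : IsCompl L.range W) : pseudoinverse L hV hW = G := by
  ext x
  have hx : x ∈ L.range := ⟨G x, h x⟩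
  have e : (L.kerComplementEquivRange hV).symm (L.range.projectionOnto W hW x) =
      ⟨G x, ⟨x, rfl⟩⟩ := by
    rw [LinearEquiv.symm_apply_eq, Submodule.projectionOnto_apply_of_mem_left hW hx]
    exact Subtype.ext (h x).symm
  exact congrArg Subtype.val e

theorem isClosed_range_of_rightInverse [T1Space B] {L : B →L[ℝ] M} {G : M →L[ℝ] B}
    (h : ∀ x, L (G x) = x) : IsClosed (G.toLinearMap.range : Set B) := by
  have e : (G.toLinearMap.range : Set B) = (fun v ↦ v - G (L v)) ⁻¹' {0} := by
    ext v
    refine ⟨?_, fun hv ↦ ⟨L v, (sub_eq_zero.1 hv).symm⟩⟩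
    rintro ⟨x, rfl⟩
    change G x - G (L (G x)) = 0
    rw [h, sub_self]
  rw [e]
  exact isClosed_singleton.preimage (by fun_prop)

end Pseudoinverse

variable {d : ℕ} {Ω K : Opens (EuclideanSpace ℝ (Fin d))} {n : ℕ∞}

/-! ### Potentials -/

namespace DiffOp

variable {P : DiffOp Ω n}

/-- Under unique continuation the seminorm of `𝓑_P` is a norm. -/
theorem UniqueContinuation.t1Space (hP : P.UniqueContinuation K) : T1Space (P.NativeSpace K) := by
  have hsep : ∀ v : P.NativeSpace K, ‖v‖ = 0 → v = 0 := fun v hv ↦ by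
    rw [NativeSpace.norm_def] at hv
    have h1 : NativeSpace.opₗ v = 0 := norm_eq_zero.1
      (le_antisymm (by linarith [norm_nonneg (NativeSpace.resₗ v)]) (norm_nonneg _))
    have h2 : NativeSpace.resₗ v = 0 := norm_eq_zero.1
      (le_antisymm (by linarith [norm_nonneg (NativeSpace.opₗ v)]) (norm_nonneg _))
    refine Subtype.ext (hP (NativeSpace.distr v) 0 ?_ (map_zero _) ?_)
    · rw [← NativeSpace.measureFunctional_opₗ, h1, map_zero]
    · rw [map_zero]
      ext φ
      have h := DFunLike.congr_fun (NativeSpace.measureFunctional_resₗ v) φ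
      rw [h2, map_zero] at h
      exact h.symm
  have : T0Space (P.NativeSpace K) := ⟨fun {v w} h ↦ by
    rw [Metric.inseparable_iff, dist_eq_norm] at h
    exact sub_eq_zero.1 (hsep _ h)⟩
  infer_instance

namespace IsGreenFunction

variable {u : Ω → C(Ω, ℝ)} (hu : P.IsGreenFunction u)
include hu

theorem continuous_uncurry : Continuous fun p : Ω × Ω ↦ u p.1 p.2 :=
  ContinuousMap.continuous_uncurry_of_continuous ⟨u, hu.continuous⟩

theorem continuous_left (y : Ω) : Continuous fun x ↦ u x y :=
  hu.continuous_uncurry.comp (by fun_prop : Continuous fun x : Ω ↦ (x, y))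

theorem integrable_left (μ : RadonMeasure Ω) (x : Ω) :
    VectorMeasure.Integrable μ (fun y ↦ u y x) := by
  obtain ⟨M, hM⟩ := hu.bounded
  exact Integrable.of_bound (hu.continuous_left x).aestronglyMeasurable M
    (Filter.Eventually.of_forall fun y ↦ hM y x)

theorem continuous_integral (μ : RadonMeasure Ω) : Continuous fun x ↦ ∫ᵛ y, u y x ∂<•μ := by
  obtain ⟨M, hM⟩ := hu.bounded
  exact VectorMeasure.continuous_of_dominated (bound := fun _ ↦ M)
    (fun x ↦ (hu.continuous_left x).aestronglyMeasurable)
    (fun x ↦ Filter.Eventually.of_forall fun y ↦ hM y x) (integrable_const M)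
    (Filter.Eventually.of_forall fun y ↦ (u y).continuous)

end IsGreenFunction

/-- The potential `x ↦ ∫ u_y(x) dμ(y)` of the measure `μ`, as a continuous function on `Ω`. -/
def potential {u : Ω → C(Ω, ℝ)} (hu : P.IsGreenFunction u) (μ : RadonMeasure Ω) : C(Ω, ℝ) :=
  ⟨fun x ↦ ∫ᵛ y, u y x ∂<•μ, hu.continuous_integral μ⟩

theorem potential_apply {u : Ω → C(Ω, ℝ)} (hu : P.IsGreenFunction u) (μ : RadonMeasure Ω) (x : Ω) :
    potential hu μ x = ∫ᵛ y, u y x ∂<•μ := rfl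

namespace IsGreenFunction

variable {u : Ω → C(Ω, ℝ)} (hu : P.IsGreenFunction u)
include hu

theorem abs_potential_le {M : ℝ} (hM : ∀ x y, |u x y| ≤ M) (μ : RadonMeasure Ω) (x : Ω) :
    |potential hu μ x| ≤ M * ‖μ‖ :=
  norm_integral_signedMeasure_le μ fun y ↦ hM y x

theorem integrable_mul {a : Ω → ℝ} (ha : Integrable a) (x : Ω) :
    Integrable fun y ↦ u x y * a y := by
  obtain ⟨M, hM⟩ := hu.bounded
  exact ha.bdd_mul (u x).continuous.aestronglyMeasurable (Filter.Eventually.of_forall (hM x))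

theorem fubini {a : Ω → ℝ} (ha : Integrable a) (μ : RadonMeasure Ω) :
    VectorMeasure.Integrable μ (fun x ↦ ∫ y, u x y * a y) ∧
    Integrable (fun y ↦ a y * ∫ᵛ x, u x y ∂<•μ) ∧
    ∫ y, a y * (∫ᵛ x, u x y ∂<•μ) = ∫ᵛ x, (∫ y, u x y * a y) ∂<•μ := by
  obtain ⟨M, hM⟩ := hu.bounded
  exact fubini_signedMeasure μ (k := fun x y ↦ u x y)
    hu.continuous_uncurry.stronglyMeasurable hM ha

/-- `P(D)` maps the potential of `μ` to `μ`: Fubini's theorem reduces this to `P(D) u_x = δ_x`. -/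
theorem apply_potential (μ : RadonMeasure Ω) :
    P.apply (ofContinuous n (potential hu μ)) = measureFunctional ⊤ μ := by
  ext φ
  have ha : Integrable fun x : Ω ↦ P.adjoint φ x :=
    ((P.adjoint φ).continuous.comp continuous_subtype_val).integrable_of_hasCompactSupport
      (hasCompactSupport_test _)
  have h : ∀ x, ∫ y : Ω, u x y * P.adjoint φ y = φ x := fun x ↦ hu.solves x φ
  have e := (hu.fubini ha μ).2.2
  simp only [h] at e
  rw [apply_apply, ofContinuous_apply, measureFunctional_apply, ← e]
  simp only [potential_apply, mul_comm]

/-- On the set `K` of finite volume, the potential of `μ` is a finite measure with a bounded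
density. -/
theorem restrict_potential (hKΩ : K ≤ Ω) [IsFiniteMeasure (volume : Measure K)]
    (μ : RadonMeasure Ω) :
    functional (restrict K (ofContinuous n (potential hu μ))) = measureFunctional n
      ((volume : Measure K).withDensityᵥ fun x ↦ potential hu μ (Set.inclusion hKΩ x)) := by
  obtain ⟨M, hM⟩ := hu.bounded
  have hf : Integrable fun x : K ↦ potential hu μ (Set.inclusion hKΩ x) :=
    Integrable.of_bound ((potential hu μ).continuous.comp
      (continuous_inclusion hKΩ)).aestronglyMeasurable (M * ‖μ‖)
      (Filter.Eventually.of_forall fun x ↦ hu.abs_potential_le hM μ _)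
  rw [ofContinuous_restrict hKΩ]
  ext φ
  rw [measureFunctional_apply, integral_withDensityᵥ hf (integrable_test _ φ)]
  rfl

theorem norm_withDensityᵥ_potential_le (hKΩ : K ≤ Ω) [IsFiniteMeasure (volume : Measure K)]
    {M : ℝ} (hM : ∀ x y, |u x y| ≤ M) (μ : RadonMeasure Ω) :
    ‖(volume : Measure K).withDensityᵥ fun x ↦ potential hu μ (Set.inclusion hKΩ x)‖ ≤
      (M * ‖μ‖) * (volume : Measure K).real Set.univ := by
  have hf : Integrable fun x : K ↦ potential hu μ (Set.inclusion hKΩ x) :=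
    Integrable.of_bound ((potential hu μ).continuous.comp
      (continuous_inclusion hKΩ)).aestronglyMeasurable (M * ‖μ‖)
      (Filter.Eventually.of_forall fun x ↦ hu.abs_potential_le hM μ _)
  rw [norm_signedMeasure_def, Measure.variation_withDensityᵥ hf, withDensity_apply _ .univ,
    Measure.restrict_univ, ← integral_norm_eq_lintegral_enorm hf.aestronglyMeasurable]
  refine (integral_mono hf.norm (integrable_const (M * ‖μ‖)) fun x ↦
    hu.abs_potential_le hM μ _).trans ?_
  rw [integral_const, smul_eq_mul, mul_comm]

end IsGreenFunction

/-! ### The Green operator -/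

/-- The operator `μ ↦ ∫ u_y dμ(y)` from `𝓜(Ω)` to `𝓑_P`. -/
def greenOpₗ {u : Ω → C(Ω, ℝ)} (hu : P.IsGreenFunction u) (hKΩ : K ≤ Ω)
    [IsFiniteMeasure (volume : Measure K)] : RadonMeasure Ω →ₗ[ℝ] P.NativeSpace K where
  toFun μ := ⟨ofContinuous n (potential hu μ), ⟨μ, hu.apply_potential μ⟩,
    ⟨_, hu.restrict_potential hKΩ μ⟩⟩
  map_add' μ ν := by
    refine Subtype.ext ?_
    ext φ
    have h : ∀ x, potential hu (μ + ν) x = potential hu μ x + potential hu ν x := fun x ↦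
      VectorMeasure.integral_add_vectorMeasure (hu.integrable_left μ x) (hu.integrable_left ν x)
    change ofContinuous n _ φ = ofContinuous n _ φ + ofContinuous n _ φ
    simp only [ofContinuous_apply, h, add_mul]
    exact integral_add (integrable_continuous_mul_test _ φ) (integrable_continuous_mul_test _ φ)
  map_smul' c μ := by
    refine Subtype.ext ?_
    ext φ
    have h : ∀ x, potential hu (c • μ) x = c * potential hu μ x := fun x ↦
      VectorMeasure.integral_smul_vectorMeasure _ c
    change ofContinuous n _ φ = c * ofContinuous n _ φ
    simp only [ofContinuous_apply, h, mul_assoc]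
    exact integral_const_mul _ _

section GreenOperator

variable {u : Ω → C(Ω, ℝ)} (hu : P.IsGreenFunction u) (hKΩ : K ≤ Ω)
  [IsFiniteMeasure (volume : Measure K)]

theorem distr_greenOpₗ (μ : RadonMeasure Ω) :
    NativeSpace.distr (greenOpₗ hu hKΩ μ) = ofContinuous n (potential hu μ) := rfl

theorem opₗ_greenOpₗ (μ : RadonMeasure Ω) : NativeSpace.opₗ (greenOpₗ hu hKΩ μ) = μ := by
  refine measureFunctional_injective (n := ⊤) ?_
  rw [NativeSpace.measureFunctional_opₗ, distr_greenOpₗ, hu.apply_potential]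

theorem resₗ_greenOpₗ (μ : RadonMeasure Ω) :
    NativeSpace.resₗ (greenOpₗ hu hKΩ μ) =
      (volume : Measure K).withDensityᵥ fun x ↦ potential hu μ (Set.inclusion hKΩ x) := by
  refine measureFunctional_injective (n := n) ?_
  rw [NativeSpace.measureFunctional_resₗ, distr_greenOpₗ, hu.restrict_potential hKΩ]

theorem exists_norm_greenOpₗ_le : ∃ C : ℝ, ∀ μ, ‖greenOpₗ hu hKΩ μ‖ ≤ C * ‖μ‖ := by
  obtain ⟨M, hM⟩ := hu.bounded
  refine ⟨1 + M * (volume : Measure K).real Set.univ, fun μ ↦ ?_⟩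
  rw [NativeSpace.norm_def, opₗ_greenOpₗ, resₗ_greenOpₗ]
  linarith [hu.norm_withDensityᵥ_potential_le hKΩ hM μ]

/-- The Green operator `μ ↦ ∫ u_y dμ(y)` is a bounded operator from `𝓜(Ω)` to `𝓑_P`. -/
def greenOp : RadonMeasure Ω →L[ℝ] P.NativeSpace K :=
  (greenOpₗ hu hKΩ).mkContinuousOfExistsBound (exists_norm_greenOpₗ_le hu hKΩ)

theorem op_greenOp (μ : RadonMeasure Ω) : NativeSpace.op P K (greenOp hu hKΩ μ) = μ :=
  opₗ_greenOpₗ hu hKΩ μ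

theorem apply_greenOp_of_isIntegration {a : Ω → ℝ} (ha : Integrable a)
    {ℓ : P.NativeSpace K →L[ℝ] ℝ} (hℓ : IsIntegration P a ℓ) (μ : RadonMeasure Ω) :
    ℓ (greenOp hu hKΩ μ) = ∫ᵛ x, (∫ y, u x y * a y) ∂<•μ := by
  obtain ⟨M, hM⟩ := hu.bounded
  rw [← (hu.fubini ha μ).2.2]
  exact hℓ _ (potential hu μ) ⟨_, hu.abs_potential_le hM μ⟩ (distr_greenOpₗ hu hKΩ μ)

end GreenOperator

/-- The function `ρ(x) = ∫ u_x(y) a(y) dy` for `a ∈ L¹(Ω)` belongs to `C₀(Ω)`. -/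
def IsGreenFunction.dual {u : Ω → C(Ω, ℝ)} (hu : P.IsGreenFunction u)
    (hv : VanishesOnCompacts u) {a : Ω → ℝ} (ha : Integrable a) : C₀(Ω, ℝ) where
  toFun x := ∫ y, u x y * a y
  continuous_toFun := by
    obtain ⟨M, hM⟩ := hu.bounded
    refine continuous_of_dominated (bound := fun y ↦ M * |a y|)
      (fun x ↦ (hu.integrable_mul ha x).aestronglyMeasurable)
      (fun x ↦ Filter.Eventually.of_forall fun y ↦ ?_) (ha.abs.const_mul M)
      (Filter.Eventually.of_forall fun y ↦ (hu.continuous_left y).mul_const _)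
    rw [Real.norm_eq_abs, abs_mul]
    exact mul_le_mul_of_nonneg_right (hM x y) (abs_nonneg _)
  zero_at_infty' := by
    obtain ⟨M, hM⟩ := hu.bounded
    have := isCountablyGenerated_cocompact Ω
    -- dominated convergence, with the hypothesis `hv` used for one-point sets only
    have h := tendsto_integral_filter_of_dominated_convergence (l := Filter.cocompact Ω)
      (F := fun x y ↦ u x y * a y) (f := fun _ ↦ 0) (μ := volume) (fun y ↦ M * |a y|)
      (Filter.Eventually.of_forall fun x ↦ (hu.integrable_mul ha x).aestronglyMeasurable)
      (Filter.Eventually.of_forall fun x ↦ Filter.Eventually.of_forall fun y ↦ ?_)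
      (ha.abs.const_mul M) (Filter.Eventually.of_forall fun y ↦ ?_)
    · rwa [integral_zero] at h
    · rw [Real.norm_eq_abs, abs_mul]
      exact mul_le_mul_of_nonneg_right (hM x y) (abs_nonneg _)
    · have hy := hv {y} isCompact_singleton
      simp only [Set.image_singleton, csSup_singleton] at hy
      simpa using ((tendsto_zero_iff_abs_tendsto_zero _).2 hy).mul_const (a y)

end DiffOp

end GreenOp

end

theorem mainTheorem7 {d : ℕ} {n : ℕ∞} {Ω K : Opens (EuclideanSpace ℝ (Fin d))}
    (hKΩ : K ≤ Ω) (hKb : Bornology.IsBounded (K : Set (EuclideanSpace ℝ (Fin d))))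
    (P : GreenOp.DiffOp Ω n) (hP : P.UniqueContinuation K)
    (u : Ω → C(Ω, ℝ)) (hu : P.IsGreenFunction u) :
    -- the structural assumptions on `L = P(D) : 𝓑_P → 𝓜(Ω)`, and surjectivity
    GreenOp.StructuralAssumption (GreenOp.DiffOp.NativeSpace.op P K) ∧
    (GreenOp.DiffOp.NativeSpace.op P K).toLinearMap.range = ⊤ ∧
    -- the pseudoinverse `L⁺`, for suitable closed complements `V` and `W`
    ∃ (V : Submodule ℝ (P.NativeSpace K)) (W : Submodule ℝ (GreenOp.RadonMeasure Ω))
      (hV : IsCompl V (GreenOp.DiffOp.NativeSpace.op P K).toLinearMap.ker)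
      (hW : IsCompl (GreenOp.DiffOp.NativeSpace.op P K).toLinearMap.range W)
      (Lplus : GreenOp.RadonMeasure Ω →L[ℝ] P.NativeSpace K),
      IsClosed (V : Set (P.NativeSpace K)) ∧
      IsClosed (W : Set (GreenOp.RadonMeasure Ω)) ∧
      Lplus.toLinearMap = GreenOp.pseudoinverse (GreenOp.DiffOp.NativeSpace.op P K).toLinearMap hV hW ∧
      -- `(L⁺ μ)(x) = ∫ u_y(x) dμ(y)`
      (∀ μ : GreenOp.RadonMeasure Ω,
        (∀ x : Ω, VectorMeasure.Integrable μ (fun y ↦ u y x)) ∧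
        ∃ f : C(Ω, ℝ), (∀ x, f x = ∫ᵛ y, u y x ∂<•μ) ∧
          GreenOp.DiffOp.NativeSpace.distr (Lplus μ) = GreenOp.ofContinuous n f) ∧
      ∀ a : Ω → ℝ, Integrable a →
        (∀ x : Ω, Integrable fun y ↦ u x y * a y) ∧
        -- `⟨a, L⁺ μ⟩ = ∫ ρ dμ` with `ρ(x) = ∫ u_x(y) a(y) dy`
        (∀ μ : GreenOp.RadonMeasure Ω,
          VectorMeasure.Integrable μ (fun x ↦ ∫ y, u x y * a y) ∧
          Integrable (fun y ↦ a y * (∫ᵛ x, u x y ∂<•μ)) ∧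
          (∫ y, a y * (∫ᵛ x, u x y ∂<•μ)) = ∫ᵛ x, (∫ y, u x y * a y) ∂<•μ) ∧
        -- `(L⁺)^* a = ρ` when `a` defines a functional `ℓ` on `𝓑_P`
        (∀ ℓ : P.NativeSpace K →L[ℝ] ℝ, GreenOp.IsIntegration P a ℓ →
          ∀ μ : GreenOp.RadonMeasure Ω,
            (ℓ.comp Lplus) μ = ∫ᵛ x, (∫ y, u x y * a y) ∂<•μ) ∧
        -- `(L⁺)^* a` belongs to `C₀(Ω)`
        (GreenOp.VanishesOnCompacts u →
          ∃ ρ : C₀(Ω, ℝ), (∀ x, ρ x = ∫ y, u x y * a y) ∧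
            ∀ ℓ : P.NativeSpace K →L[ℝ] ℝ, GreenOp.IsIntegration P a ℓ →
              ∀ μ : GreenOp.RadonMeasure Ω, (ℓ.comp Lplus) μ = ∫ᵛ x, ρ x ∂<•μ) := by
  have hfin := GreenOp.isFiniteMeasure_volume_opens hKb
  have hT1 := hP.t1Space
  let G := GreenOp.DiffOp.greenOp (K := K) hu hKΩ
  have hG : ∀ μ, GreenOp.DiffOp.NativeSpace.op P K (G μ) = μ :=
    GreenOp.DiffOp.op_greenOp hu hKΩ
  have hrange : (GreenOp.DiffOp.NativeSpace.op P K).toLinearMap.range = ⊤ :=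
    LinearMap.range_eq_top.2 fun μ ↦ ⟨G μ, hG μ⟩
  have hV : IsCompl G.toLinearMap.range (GreenOp.DiffOp.NativeSpace.op P K).toLinearMap.ker :=
    GreenOp.isCompl_range_ker_of_rightInverse hG
  have hW : IsCompl (GreenOp.DiffOp.NativeSpace.op P K).toLinearMap.range ⊥ := by
    rw [hrange]
    exact isCompl_top_bot
  have hVc := GreenOp.isClosed_range_of_rightInverse hG
  have hWc : IsClosed ((⊥ : Submodule ℝ (GreenOp.RadonMeasure Ω)) : Set (GreenOp.RadonMeasure Ω)) :=
    isClosed_singleton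
  refine ⟨⟨⟨_, hVc, hV⟩, ?_, ⟨⊥, hWc, hW⟩⟩, hrange, _, ⊥, hV, hW, G, hVc, hWc,
    (GreenOp.pseudoinverse_eq_of_rightInverse hG hV hW).symm,
    fun μ ↦ ⟨hu.integrable_left μ, GreenOp.DiffOp.potential hu μ, fun _ ↦ rfl, rfl⟩,
    fun a ha ↦ ⟨hu.integrable_mul ha, hu.fubini ha,
      fun ℓ hℓ ↦ GreenOp.DiffOp.apply_greenOp_of_isIntegration hu hKΩ ha hℓ,
      fun hv ↦ ⟨hu.dual hv ha, fun _ ↦ rfl,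
        fun ℓ hℓ ↦ GreenOp.DiffOp.apply_greenOp_of_isIntegration hu hKΩ ha hℓ⟩⟩⟩
  rw [hrange]
  exact isClosed_univ
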